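/- Let $\mathbb F$ be a field and $p=x^s+c_{s-1}x^{s-1}+\dots+c_0\in\mathbb F[x]$ a monic irreducible polynomial. Let $C\in M_s(\mathbb F)$ be its companion matrix (ones below the diagonal, last column $(-c_0,\dots,-c_{s-1})^T$), and let $E\in M_s(\mathbb F)$ have a single nonzero entry, a $1$ in position $(1,s)$. Write $Z(A)=\{B: AB=BA\}$. For $X=[x_{u,v}]\in M_s(\mathbb F)$ let $\tilde X\in M_s(\mathbb F)$ be the matrix with entries $\tilde x_{u,v}=x_{s,v-u}$ for $u<v$ and $\tilde x_{u,v}=0$ for $u\ge v$; for a matrix $Y$ of $s\times s$ blocks, $\tilde Y$ is obtained by applying this to each block. Let $\alpha=(\alpha_1\ge\dots\ge\alpha_m\ge0)$ with $\ell=\alpha_1\ge1$, and let $\tau=(\tau_1,\dots,\tau_\ell)$ be its conjugate partition, $\tau_i=\#\{k:\alpha_k\ge i\}$. The generalized Weyr matrix with generalized Segre characteristic $\alpha$ is $$W=\begin{bmatrix}W_1&E_2&&\\&W_2&\ddots&\\&&\ddots&E_\ell\\&&&W_\ell\end{bmatrix},\qquad W_i=\operatorname{diag}(C,\dots,C)\in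 M_{s\tau_i}(\mathbb F),\qquad E_{i+1}=\begin{bmatrix}\operatorname{diag}(E,\dots,E)\\0\end{bmatrix}\in M_{s\tau_i\times s\tau_{i+1}}(\mathbb F),$$ with zeros elsewhere. **Theorem 6.1.** Every $K\in Z(W)$ is block upper triangular, $K=[K_{i,j}]_{1\le i,j\le\ell}$ with $K_{i,j}\in M_{s\tau_i\times s\tau_j}(\mathbb F)$ and $K_{i,j}=0$ for $i>j$, and is built by the following recursion: 1. $K_{\ell,\ell}$ is a $\tau_\ell\times\tau_\ell$ block matrix with blocks in $Z(C)$. 2. For $1\le i\le\ell-1$, $K_{i,i}=\begin{bmatrix}K_{i+1,i+1}&Y_{i,i}\\0&X_{i,i}\end{bmatrix}$, where $X_{i,i}$ consists of $(\tau_i-\tau_{i+1})\times(\tau_i-\tau_{i+1})$ blocks of $Z(C)$ and $Y_{i,i}$ of $\tau_{i+1}\times(\tau_i-\tau_{i+1})$ blocks of $Z(C)$. 3. For $1\le i\le\ell-1$, $K_{i,\ell}=\begin{bmatrix}Y_{i,\ell}\\X_{i,\ell}\end{bmatrix}$, where $X_{i,\ell}$ consists of $(\tau_i-\tau_{i+1})\times\tau_\ell$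 blocks of $Z(C)$ and $Y_{i,\ell}=Y'_{i,\ell}+\begin{bmatrix}\tilde Y_{i+1,\ell}\\\tilde X_{i+1,\ell}\end{bmatrix}$, with $Y'_{i,\ell}$ consisting of $\tau_{i+1}\times\tau_\ell$ blocks of $Z(C)$; here $Y_{\ell,\ell}=K_{\ell,\ell}$ and $X_{\ell,\ell}$ is empty. 4. For $1\le i<j\le\ell-1$, $K_{i,j}=\begin{bmatrix}K_{i+1,j+1}&Y_{i,j}\\0&X_{i,j}\end{bmatrix}$, where $X_{i,j}$ consists of $(\tau_i-\tau_{i+1})\times(\tau_j-\tau_{j+1})$ blocks of $Z(C)$ and $Y_{i,j}=Y'_{i,j}+\begin{bmatrix}\tilde Y_{i+1,j}\\\tilde X_{i+1,j}\end{bmatrix}$, with $Y'_{i,j}$ consisting of $\tau_{i+1}\times(\tau_j-\tau_{j+1})$ blocks of $Z(C)$. The $Z(C)$-blocks of $K_{\ell,\ell}$, of the $Y_{i,i}$, of all the $X_{i,j}$ in 2--4 and of all the $Y'_{i,j}$ in 3--4 are independent: each $K\in Z(W)$ arises from exactly one choice of them, each choice of them in $Z(C)$ determines exactly one matrix $K$,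 and this $K$ lies in $Z(W)$. Consequently, $\det K=\det K_{1,1}\,\det K_{2,2}\cdots\det K_{\ell,\ell}$ for every $K\in Z(W)$. -/

import Mathlib

namespace GenWeyr

open Polynomial

/-- The companion matrix of `p` (for `p` monic of degree `s`): ones below the diagonal and last
column `-c_0, …, -c_{s-1}`, where `c_u` is the coefficient of `x ^ u` in `p`. -/
def companionMatrix {F : Type*} [Field F] (p : F[X]) :
    Matrix (Fin p.natDegree) (Fin p.natDegree) F :=
  Matrix.of fun u v =>
    if (v : ℕ) + 1 = p.natDegree then -p.coeff (u : ℕ)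
    else if (u : ℕ) = (v : ℕ) + 1 then 1 else 0

/-- The `s × s` matrix whose only nonzero entry is a `1` in the top right corner. -/
def cornerMatrix (F : Type*) [Field F] (s : ℕ) : Matrix (Fin s) (Fin s) F :=
  Matrix.of fun u v => if (u : ℕ) = 0 ∧ (v : ℕ) + 1 = s then 1 else 0

/-- The centralizer `Z(A) = {B | A * B = B * A}`. -/
abbrev centralizerOf {F n : Type*} [Field F] [Fintype n] [DecidableEq n] (A : Matrix n n F) :
    Subalgebra F (Matrix n n F) :=
  Subalgebra.centralizer F {A}

/-- The matrix `X̃`: strictly upper triangular and constant along diagonals, its first row being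
`0, x_{s,1}, …, x_{s,s-1}`, i.e. the last row of `X` shifted by one place. -/
def tilde {F : Type*} [Field F] {s : ℕ} (X : Matrix (Fin s) (Fin s) F) :
    Matrix (Fin s) (Fin s) F :=
  Matrix.of fun u v =>
    if u < v then
      X ⟨s - 1, by have := v.isLt; omega⟩ ⟨(v : ℕ) - (u : ℕ) - 1, by have := v.isLt; omega⟩
    else 0

/-- The conjugate partition of `α`, indexed from `0`: `conjPart α i` is the number of parts of `α`
that are at least `i + 1`. -/
def conjPart {m : ℕ} (α : Fin m → ℕ) (i : ℕ) : ℕ :=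
  (Finset.univ.filter fun k : Fin m => i + 1 ≤ α k).card

theorem conjPart_succ_le {m : ℕ} (α : Fin m → ℕ) (i : ℕ) :
    conjPart α (i + 1) ≤ conjPart α i := by
  apply Finset.card_le_card
  intro k hk
  simp only [Finset.mem_filter, Finset.mem_univ, true_and] at hk ⊢
  omega

/-- Index set of a generalized Weyr matrix with diagonal blocks numbered `0, …, L`: block row `i`
consists of `τ_i` rows of `s × s` blocks. -/
abbrev WeyrIndex {m : ℕ} (α : Fin m → ℕ) (L s : ℕ) : Type :=
  Σ i : Fin (L + 1), Fin (conjPart α i) × Fin s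

/-- The block in position `(i, j)` of the generalized Weyr form, as a `τ_i × τ_j` matrix of
`s × s` blocks: `diag(C, …, C)` for `j = i`, the matrix `[diag(E, …, E); 0]` for `j = i + 1`, and
zero otherwise. -/
def weyrBlock {F : Type*} [Field F] {m : ℕ} (p : F[X]) (α : Fin m → ℕ) (i j : ℕ) :
    Matrix (Fin (conjPart α i)) (Fin (conjPart α j))
      (Matrix (Fin p.natDegree) (Fin p.natDegree) F) :=
  Matrix.of fun a b =>
    if j = i ∧ (a : ℕ) = (b : ℕ) then companionMatrix p
    else if j = i + 1 ∧ (a : ℕ) = (b : ℕ) then cornerMatrix F p.natDegree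
    else 0

/-- The generalized Weyr form with generalized Segre characteristic `α` (where `α_1 = L + 1`). -/
def weyrMatrix {F : Type*} [Field F] {m : ℕ} (p : F[X]) (α : Fin m → ℕ) (L : ℕ) :
    Matrix (WeyrIndex α L p.natDegree) (WeyrIndex α L p.natDegree) F :=
  Matrix.of fun x y => weyrBlock p α x.1 y.1 x.2.1 y.2.1 x.2.2 y.2.2

/-- The block `K_{i,j}` as a `τ_i × τ_j` matrix of `s × s` blocks. -/
def blk {F : Type*} {m : ℕ} {α : Fin m → ℕ} {L s : ℕ}
    (K : Matrix (WeyrIndex α L s) (WeyrIndex α L s) F) (i j : ℕ) (hi : i ≤ L) (hj : j ≤ L) :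
    Matrix (Fin (conjPart α i)) (Fin (conjPart α j)) (Matrix (Fin s) (Fin s) F) :=
  Matrix.of fun a b => Matrix.of fun u v =>
    K ⟨⟨i, Nat.lt_succ_of_le hi⟩, a, u⟩ ⟨⟨j, Nat.lt_succ_of_le hj⟩, b, v⟩

/-- The splitting of `τ_i` indices into the first `τ_{i+1}` and the last `τ_i - τ_{i+1}`. -/
def splitEquiv {m : ℕ} (α : Fin m → ℕ) (i : ℕ) :
    Fin (conjPart α (i + 1)) ⊕ Fin (conjPart α i - conjPart α (i + 1)) ≃ Fin (conjPart α i) :=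
  finSumFinEquiv.trans (finCongr (Nat.add_sub_cancel' (conjPart_succ_le α i)))

/-- The matrix `[A, Y; 0, X]` with `τ_i × τ_j` entries, where `A` has `τ_{i+1} × τ_{j+1}`. -/
def glue {M : Type*} [Zero M] {m : ℕ} (α : Fin m → ℕ) (i j : ℕ)
    (A : Matrix (Fin (conjPart α (i + 1))) (Fin (conjPart α (j + 1))) M)
    (Y : Matrix (Fin (conjPart α (i + 1))) (Fin (conjPart α j - conjPart α (j + 1))) M)
    (X : Matrix (Fin (conjPart α i - conjPart α (i + 1)))
      (Fin (conjPart α j - conjPart α (j + 1))) M) :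
    Matrix (Fin (conjPart α i)) (Fin (conjPart α j)) M :=
  Matrix.reindex (splitEquiv α i) (splitEquiv α j) (Matrix.fromBlocks A Y 0 X)

/-- The matrix `[Y; X]` with `τ_i` rows, where `Y` has `τ_{i+1}` rows. -/
def stack {M q : Type*} {m : ℕ} (α : Fin m → ℕ) (i : ℕ)
    (Y : Matrix (Fin (conjPart α (i + 1))) q M)
    (X : Matrix (Fin (conjPart α i - conjPart α (i + 1))) q M) :
    Matrix (Fin (conjPart α i)) q M :=
  Matrix.reindex (splitEquiv α i) (Equiv.refl q) (Matrix.fromRows Y X)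

/-- The independent blocks out of which a matrix of the centralizer is built; all of them lie in
`Z` (to be taken as `Z(C)`). Block rows and columns are numbered `0, …, L`. -/
structure FreeBlocks {m : ℕ} (α : Fin m → ℕ) (L : ℕ) (Z : Type*) where
  /-- the last diagonal block `K_{L,L}` -/
  corner : Matrix (Fin (conjPart α L)) (Fin (conjPart α L)) Z
  /-- `X_{i,L}` -/
  lastX : ∀ i : ℕ, i < L → Matrix (Fin (conjPart α i - conjPart α (i + 1))) (Fin (conjPart α L)) Z
  /-- `Y'_{i,L}` -/
  lastY' : ∀ i : ℕ, i < L → Matrix (Fin (conjPart α (i + 1))) (Fin (conjPart α L)) Z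
  /-- `X_{i,j}` for `i ≤ j < L` -/
  X : ∀ i j : ℕ, i ≤ j → j < L →
    Matrix (Fin (conjPart α i - conjPart α (i + 1))) (Fin (conjPart α j - conjPart α (j + 1))) Z
  /-- `Y'_{i,j}` for `i ≤ j < L`, with `Y'_{i,i} = Y_{i,i}` -/
  Y' : ∀ i j : ℕ, i ≤ j → j < L →
    Matrix (Fin (conjPart α (i + 1))) (Fin (conjPart α j - conjPart α (j + 1))) Z

/-- The recursive construction of the block matrix `K` from its free blocks, `Y_{i,L}` being
`YL i` and `Y_{i,j}` being `Y i j`. -/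
structure BuiltWith {F : Type*} [Field F] {m : ℕ} {α : Fin m → ℕ} {L s : ℕ}
    {Z : Set (Matrix (Fin s) (Fin s) F)}
    (K : Matrix (WeyrIndex α L s) (WeyrIndex α L s) F) (P : FreeBlocks α L Z)
    (YL : ∀ i : ℕ, Matrix (Fin (conjPart α (i + 1))) (Fin (conjPart α L))
      (Matrix (Fin s) (Fin s) F))
    (Y : ∀ i j : ℕ, Matrix (Fin (conjPart α (i + 1))) (Fin (conjPart α j - conjPart α (j + 1)))
      (Matrix (Fin s) (Fin s) F)) : Prop where
  /-- the blocks below the diagonal vanish -/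
  lower : ∀ (i j : ℕ) (hi : i ≤ L) (hji : j < i), blk K i j hi (hji.le.trans hi) = 0
  /-- the last diagonal block -/
  corner : blk K L L le_rfl le_rfl = P.corner.map Subtype.val
  /-- the other diagonal blocks: `K_{i,i} = [K_{i+1,i+1}, Y_{i,i}; 0, X_{i,i}]` -/
  diag : ∀ (i : ℕ) (hi : i < L),
    blk K i i hi.le hi.le =
      glue α i i (blk K (i + 1) (i + 1) hi hi) (Y i i)
        ((P.X i i le_rfl hi).map Subtype.val)
  /-- `Y_{i,i}` is free -/
  diagY : ∀ (i : ℕ) (hi : i < L), Y i i = (P.Y' i i le_rfl hi).map Subtype.val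
  /-- the last block column: `K_{i,L} = [Y_{i,L}; X_{i,L}]` -/
  last : ∀ (i : ℕ) (hi : i < L),
    blk K i L hi.le le_rfl = stack α i (YL i) ((P.lastX i hi).map Subtype.val)
  /-- `Y_{i,L}` is a free matrix plus the tilde of `[Y_{i+1,L}; X_{i+1,L}] = K_{i+1,L}`
  (for `i + 1 = L`, the tilde of the last diagonal block `K_{L,L}`) -/
  lastY : ∀ (i : ℕ) (hi : i < L),
    YL i = (P.lastY' i hi).map Subtype.val + (blk K (i + 1) L hi le_rfl).map tilde
  /-- the remaining blocks: `K_{i,j} = [K_{i+1,j+1}, Y_{i,j}; 0, X_{i,j}]` -/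
  upper : ∀ (i j : ℕ) (hij : i < j) (hj : j < L),
    blk K i j (hij.le.trans hj.le) hj.le =
      glue α i j (blk K (i + 1) (j + 1) (hij.trans hj) hj) (Y i j)
        ((P.X i j hij.le hj).map Subtype.val)
  /-- `Y_{i,j}` is a free matrix plus the tilde of `[Y_{i+1,j}; X_{i+1,j}]` -/
  upperY : ∀ (i j : ℕ) (hij : i < j) (hj : j < L),
    Y i j = (P.Y' i j hij.le hj).map Subtype.val +
      (stack α (i + 1) (Y (i + 1) j) ((P.X (i + 1) j hij hj).map Subtype.val)).map tilde

/-- `K` arises by the recursive construction from the free blocks `P`. -/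
def IsBuiltFrom {F : Type*} [Field F] {m : ℕ} {α : Fin m → ℕ} {L s : ℕ}
    {Z : Set (Matrix (Fin s) (Fin s) F)}
    (K : Matrix (WeyrIndex α L s) (WeyrIndex α L s) F) (P : FreeBlocks α L Z) : Prop :=
  ∃ YL Y, BuiltWith K P YL Y

end GenWeyr

/-! Fix a position (a, b) inside the blocks K_{i,j} and let κ_{i,j} be the s × s block found there.
As W has C on its diagonal and E just above it, WK = KW splits into one system for each (a, b),
namely Cκ_{i,j} − κ_{i,j}C = κ_{i,j−1}E − Eκ_{i+1,j}, on a rectangular array bordered by zeros on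
the left and below.

Two facts about C solve it. For A in Z(C), Ã is a particular solution X of CX − XC = AE − EA
(`commutator_tilde`); and for A, B in Z(C), AE − EB has the form CX − XC only if A = B
(`eq_of_commutator_eq`). Since tilde squares to zero and tildes are killed by E on both sides, both
facts survive when A and B lie in Z(C) only up to a common tilde. Hence κ is constant along
diagonals and κ_{i,j} minus the tilde of κ_{i+1,j} lies in Z(C) (`toeplitz_of_commutator`).

The zero column on the left forces the blocks below the diagonal to vanish. Each diagonal is
determined where it meets the last column containing b, and there the difference in Z(C) is the free
block. `EntryRecursion` records this, and `isBuiltFrom_ofEntries` identifies it with the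
construction by blocks. -/

namespace GenWeyr

open Polynomial

/-! ### Commutators with the companion matrix -/

section LinearAlgebra

variable {F : Type*} [Field F]

theorem mem_centralizerOf {n : Type*} [Fintype n] [DecidableEq n] {A B : Matrix n n F} :
    B ∈ centralizerOf A ↔ A * B = B * A := by
  simp [Subalgebra.mem_centralizer_iff]

theorem tilde_add {s : ℕ} (X Y : Matrix (Fin s) (Fin s) F) :
    tilde (X + Y) = tilde X + tilde Y := by
  ext u v
  simp only [tilde, Matrix.of_apply, Matrix.add_apply]
  split_ifs <;> simp

@[simp] theorem tilde_zero {s : ℕ} : tilde (0 : Matrix (Fin s) (Fin s) F) = 0 := by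
  ext u v
  simp [tilde]

theorem tilde_tilde {s : ℕ} (X : Matrix (Fin s) (Fin s) F) : tilde (tilde X) = 0 := by
  ext u v
  simp only [tilde, Matrix.of_apply, Matrix.zero_apply]
  split_ifs with h1 h2
  · simp only [Fin.lt_def] at h1 h2
    omega
  · rfl
  · rfl

theorem cornerMatrix_mul_apply {s : ℕ} (X : Matrix (Fin s) (Fin s) F) (u v : Fin s) :
    (cornerMatrix F s * X) u v =
      if (u : ℕ) = 0 then X ⟨s - 1, by have := v.isLt; omega⟩ v else 0 := by
  have hs := u.isLt
  rw [Matrix.mul_apply, Finset.sum_eq_single ⟨s - 1, by omega⟩]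
  · have : s - 1 + 1 = s := by omega
    simp [cornerMatrix, this]
  · intro w _ hw
    have : (w : ℕ) + 1 ≠ s := fun h => hw (Fin.ext (by simp; omega))
    simp [cornerMatrix, this]
  · simp

theorem mul_cornerMatrix_apply {s : ℕ} (X : Matrix (Fin s) (Fin s) F) (u v : Fin s) :
    (X * cornerMatrix F s) u v =
      if (v : ℕ) + 1 = s then X u ⟨0, by have := v.isLt; omega⟩ else 0 := by
  have hs := u.isLt
  rw [Matrix.mul_apply, Finset.sum_eq_single ⟨0, by omega⟩]
  · simp [cornerMatrix]
  · intro w _ hw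
    have : (w : ℕ) ≠ 0 := fun h => hw (Fin.ext (by simp; omega))
    simp [cornerMatrix, this]
  · simp

theorem tilde_mul_cornerMatrix {s : ℕ} (X : Matrix (Fin s) (Fin s) F) :
    tilde X * cornerMatrix F s = 0 := by
  ext u v
  rw [mul_cornerMatrix_apply]
  simp only [tilde, Matrix.of_apply, Fin.lt_def]
  simp

theorem cornerMatrix_mul_tilde {s : ℕ} (X : Matrix (Fin s) (Fin s) F) :
    cornerMatrix F s * tilde X = 0 := by
  ext u v
  rw [cornerMatrix_mul_apply]
  have : ¬ (s - 1 < (v : ℕ)) := by have := v.isLt; omega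
  simp only [tilde, Matrix.of_apply, Fin.lt_def, this]
  simp

theorem trace_cornerMatrix_mul {s : ℕ} (hs : 0 < s) (X : Matrix (Fin s) (Fin s) F) :
    (cornerMatrix F s * X).trace = X ⟨s - 1, by omega⟩ ⟨0, hs⟩ := by
  rw [Matrix.trace, Finset.sum_eq_single ⟨0, hs⟩]
  · simp [cornerMatrix_mul_apply]
  · intro w _ hw
    have : (w : ℕ) ≠ 0 := fun h => hw (Fin.ext (by simp; omega))
    simp [cornerMatrix_mul_apply, this]
  · simp

variable {p : F[X]}

theorem mul_companionMatrix_apply_of_lt (X : Matrix (Fin p.natDegree) (Fin p.natDegree) F)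
    (u : Fin p.natDegree) (v : ℕ) (hv : v + 1 < p.natDegree) :
    (X * companionMatrix p) u ⟨v, by omega⟩ = X u ⟨v + 1, hv⟩ := by
  rw [Matrix.mul_apply, Finset.sum_eq_single ⟨v + 1, hv⟩]
  · simp [companionMatrix, hv.ne]
  · intro w _ hw
    have : (w : ℕ) ≠ v + 1 := fun h => hw (Fin.ext (by simp; omega))
    simp [companionMatrix, hv.ne, this]
  · simp

theorem mul_companionMatrix_apply_last (X : Matrix (Fin p.natDegree) (Fin p.natDegree) F)
    (u v : Fin p.natDegree) (hv : (v : ℕ) + 1 = p.natDegree) :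
    (X * companionMatrix p) u v = -∑ w, X u w * p.coeff (w : ℕ) := by
  simp [Matrix.mul_apply, companionMatrix, hv]

theorem companionMatrix_mul_apply_succ (X : Matrix (Fin p.natDegree) (Fin p.natDegree) F)
    (u : ℕ) (hu : u + 1 < p.natDegree) (v : Fin p.natDegree) :
    (companionMatrix p * X) ⟨u + 1, hu⟩ v =
      X ⟨u, by omega⟩ v - p.coeff (u + 1) * X ⟨p.natDegree - 1, by omega⟩ v := by
  have h1 : p.natDegree - 1 + 1 = p.natDegree := by omega
  have hne : (⟨u, by omega⟩ : Fin p.natDegree) ≠ ⟨p.natDegree - 1, by omega⟩ := by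
    simp only [ne_eq, Fin.mk.injEq]; omega
  rw [Matrix.mul_apply, Finset.sum_eq_add _ _ hne]
  · simp [companionMatrix, h1, hu.ne]
    ring
  · rintro w - ⟨hw1, hw2⟩
    have h2 : (w : ℕ) + 1 ≠ p.natDegree := fun h => hw2 (Fin.ext (by simp; omega))
    have h3 : u ≠ (w : ℕ) := fun h => hw1 (Fin.ext h.symm)
    simp [companionMatrix, h2, h3]
  · simp
  · simp

theorem companionMatrix_mul_apply_zero (X : Matrix (Fin p.natDegree) (Fin p.natDegree) F)
    (hs : 0 < p.natDegree) (v : Fin p.natDegree) :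
    (companionMatrix p * X) ⟨0, hs⟩ v =
      -(p.coeff 0 * X ⟨p.natDegree - 1, by omega⟩ v) := by
  have h1 : p.natDegree - 1 + 1 = p.natDegree := by omega
  rw [Matrix.mul_apply, Finset.sum_eq_single ⟨p.natDegree - 1, by omega⟩]
  · simp [companionMatrix, h1]
  · intro w _ hw
    have h2 : (w : ℕ) + 1 ≠ p.natDegree := fun h => hw (Fin.ext (by simp; omega))
    simp [companionMatrix, h2]
  · simp

/-- The entries of a matrix commuting with a companion matrix follow a recursion along
diagonals. -/
theorem apply_eq_of_commute {A : Matrix (Fin p.natDegree) (Fin p.natDegree) F}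
    (hA : companionMatrix p * A = A * companionMatrix p) (u v : ℕ)
    (hu : u + 1 < p.natDegree) (hv : v + 1 < p.natDegree) :
    A ⟨u, by omega⟩ ⟨v, by omega⟩ =
      p.coeff (u + 1) * A ⟨p.natDegree - 1, by omega⟩ ⟨v, by omega⟩ +
        A ⟨u + 1, hu⟩ ⟨v + 1, hv⟩ := by
  have h := congrFun (congrFun hA ⟨u + 1, hu⟩) ⟨v, by omega⟩
  rw [companionMatrix_mul_apply_succ, mul_companionMatrix_apply_of_lt _ _ _ hv] at h
  linear_combination h

/-- Iterates the diagonal recursion from (u, 0). With n = s − 1 − u it reaches the last row, which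
is what the last column of Ã C requires. -/
theorem apply_zero_eq_sum_of_commute {A : Matrix (Fin p.natDegree) (Fin p.natDegree) F}
    (hA : companionMatrix p * A = A * companionMatrix p) (u n : ℕ)
    (hu : u + n < p.natDegree) :
    A ⟨u, by omega⟩ ⟨0, by omega⟩ =
      (∑ t : Fin n, p.coeff (u + 1 + t) * A ⟨p.natDegree - 1, by omega⟩ ⟨t, by omega⟩) +
        A ⟨u + n, hu⟩ ⟨n, by omega⟩ := by
  induction n with
  | zero => simp
  | succ n ih =>
    rw [ih (by omega), apply_eq_of_commute hA (u + n) n (by omega) (by omega),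
      Fin.sum_univ_castSucc]
    simp only [Fin.val_castSucc, Fin.val_last]
    rw [show u + 1 + n = u + n + 1 by ring]
    simp only [add_assoc]

/-- Row u + 1 of CD = DC gives row u of D from row u + 1 and the last row, so zero rows propagate
upwards. -/
theorem eq_zero_of_commute_of_last_row {D : Matrix (Fin p.natDegree) (Fin p.natDegree) F}
    (hD : companionMatrix p * D = D * companionMatrix p)
    (hlast : ∀ u v : Fin p.natDegree, (u : ℕ) + 1 = p.natDegree → D u v = 0) : D = 0 := by
  have key : ∀ n : ℕ, ∀ u v : Fin p.natDegree, (u : ℕ) + 1 + n = p.natDegree → D u v = 0 := by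
    intro n
    induction n with
    | zero => intro u v h; exact hlast u v h
    | succ n ih =>
      intro u v h
      have hu : (u : ℕ) + 1 < p.natDegree := by omega
      have h1 := congrFun (congrFun hD ⟨u + 1, hu⟩) v
      rw [companionMatrix_mul_apply_succ, hlast ⟨p.natDegree - 1, _⟩ v (by simp; omega),
        Matrix.mul_apply, Finset.sum_eq_zero] at h1
      · simpa using h1
      · intro w _
        rw [ih ⟨u + 1, hu⟩ w (by simp; omega), zero_mul]
  ext u v
  exact key (p.natDegree - 1 - u) u v (by omega)

/-- The first basis vector is cyclic: C^k sends it to the basis vector with index k. -/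
theorem mul_companionMatrix_pow_apply (X : Matrix (Fin p.natDegree) (Fin p.natDegree) F)
    (u : Fin p.natDegree) (k : ℕ) (hk : k < p.natDegree) :
    (X * companionMatrix p ^ k) u ⟨0, by omega⟩ = X u ⟨k, hk⟩ := by
  induction k generalizing X with
  | zero => simp
  | succ k ih =>
    rw [pow_succ', ← mul_assoc, ih _ (by omega), mul_companionMatrix_apply_of_lt _ _ _ hk]

/-- `C Ã - Ã C = A E - E A` for `A` in the centralizer of `C`. -/
theorem commutator_tilde {A : Matrix (Fin p.natDegree) (Fin p.natDegree) F}
    (hA : companionMatrix p * A = A * companionMatrix p) :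
    companionMatrix p * tilde A - tilde A * companionMatrix p =
      A * cornerMatrix F p.natDegree - cornerMatrix F p.natDegree * A := by
  ext ⟨u, hu⟩ ⟨v, hv⟩
  rw [Matrix.sub_apply, Matrix.sub_apply, mul_cornerMatrix_apply, cornerMatrix_mul_apply]
  -- The last row of Ã is zero, so left multiplication by C merely shifts its rows down.
  have hrow : (companionMatrix p * tilde A) ⟨u, hu⟩ ⟨v, hv⟩ =
      if h : 0 < u ∧ u ≤ v then A ⟨p.natDegree - 1, by omega⟩ ⟨v - u, by omega⟩ else 0 := by
    obtain _ | u := u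
    · rw [companionMatrix_mul_apply_zero]
      have : ¬ p.natDegree - 1 < v := by omega
      simp [tilde, this]
    · rw [companionMatrix_mul_apply_succ]
      have h1 : ¬ p.natDegree - 1 < v := by omega
      simp only [tilde, Matrix.of_apply, Fin.mk_lt_mk, h1, if_false]
      by_cases h : u < v
      · rw [if_pos h, dif_pos ⟨by omega, h⟩]
        simp only [mul_zero, sub_zero]
        congr 2
      · rw [if_neg h, dif_neg (by omega)]
        simp
  rw [hrow]
  -- In the last column the coefficients of p enter; elsewhere Ã C is a shift of columns, and the
  -- Toeplitz shape cancels all but row 0.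
  by_cases hvl : v + 1 = p.natDegree
  · rw [mul_companionMatrix_apply_last _ _ _ hvl, if_pos hvl,
      apply_zero_eq_sum_of_commute hA u (p.natDegree - 1 - u) (by omega)]
    have hsum : ∑ w : Fin p.natDegree, tilde A ⟨u, hu⟩ w * p.coeff (w : ℕ) =
        ∑ t : Fin (p.natDegree - 1 - u),
          p.coeff (u + 1 + t) * A ⟨p.natDegree - 1, by omega⟩ ⟨t, by omega⟩ := by
      symm
      refine Finset.sum_of_injOn (fun t : Fin (p.natDegree - 1 - u) =>
        (⟨u + 1 + t, by omega⟩ : Fin p.natDegree)) ?_ ?_ ?_ ?_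
      · intro a _ b _ h
        simp only [Fin.mk.injEq] at h
        exact Fin.ext (by omega)
      · intro a _; simp
      · intro w _ hw
        have : ¬ u < (w : ℕ) := by
          intro h
          apply hw
          simp only [Finset.coe_univ, Set.image_univ, Set.mem_range]
          exact ⟨⟨w - (u + 1), by omega⟩, Fin.ext (by simp; omega)⟩
        simp only [tilde, Matrix.of_apply, Fin.lt_def, this]
        simp
      · intro t _
        have h1 : u < u + 1 + (t : ℕ) := by omega
        simp only [tilde, Matrix.of_apply, Fin.mk_lt_mk, h1, if_true]
        rw [mul_comm]
        congr 3
        omega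
    rw [hsum]
    have e1 : (⟨u + (p.natDegree - 1 - u), by omega⟩ : Fin p.natDegree) =
      ⟨p.natDegree - 1, by omega⟩ := Fin.ext (by simp; omega)
    have e2 : (⟨p.natDegree - 1 - u, by omega⟩ : Fin p.natDegree) =
      ⟨v - u, by omega⟩ := Fin.ext (by simp; omega)
    rw [e1, e2]
    by_cases h : u = 0
    · subst h
      simp
    · rw [dif_pos ⟨by omega, by omega⟩, if_neg h]
      ring
  · rw [mul_companionMatrix_apply_of_lt _ _ _ (by omega), if_neg hvl]
    simp only [tilde, Matrix.of_apply, Fin.mk_lt_mk]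
    by_cases h : u = 0
    · subst h
      simp
    · by_cases huv : u ≤ v
      · rw [dif_pos ⟨by omega, huv⟩, if_pos (by omega), if_neg h, zero_sub, neg_zero, sub_eq_zero]
        congr 2
        omega
      · rw [dif_neg (by omega), if_neg (by omega), if_neg h]

/-- A matrix `A E - E B` with `A`, `B` in the centralizer of `C` is a commutator `C X - X C` only
if `A = B`. -/
theorem eq_of_commutator_eq {A B X : Matrix (Fin p.natDegree) (Fin p.natDegree) F}
    (hA : companionMatrix p * A = A * companionMatrix p)
    (hB : companionMatrix p * B = B * companionMatrix p)
    (h : companionMatrix p * X - X * companionMatrix p =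
      A * cornerMatrix F p.natDegree - cornerMatrix F p.natDegree * B) : A = B := by
  rw [← sub_eq_zero]
  apply eq_zero_of_commute_of_last_row (p := p)
  · rw [mul_sub, sub_mul, hA, hB]
  intro u v hu
  have hs : 0 < p.natDegree := by omega
  have hAk : Commute (companionMatrix p ^ (v : ℕ)) A := Commute.pow_left hA _
  -- The trace against C^v kills CX − XC, while tr(C^v A E) and tr(C^v E B) are the entries of A and
  -- B in the last row and column v.
  have htr := congrArg (fun M => (companionMatrix p ^ (v : ℕ) * M).trace) h
  simp only [mul_sub, Matrix.trace_sub] at htr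
  rw [← mul_assoc, ← pow_succ, ← mul_assoc, Matrix.trace_mul_comm (_ * X), ← mul_assoc,
    ← pow_succ', sub_self, ← mul_assoc, hAk.eq, Matrix.trace_mul_comm _ (cornerMatrix F _),
    trace_cornerMatrix_mul hs, Matrix.trace_mul_comm, mul_assoc, trace_cornerMatrix_mul hs,
    mul_companionMatrix_pow_apply _ _ _ v.isLt, mul_companionMatrix_pow_apply _ _ _ v.isLt] at htr
  have hu' : u = ⟨p.natDegree - 1, by omega⟩ := Fin.ext (by simp; omega)
  rw [hu', Matrix.sub_apply]
  exact htr.symm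

end LinearAlgebra

/-! ### Solving the commutator equations on an array -/

section Toeplitz

variable {F : Type*} [Field F] {p : F[X]}

/-- `C (Z + Ã) - (Z + Ã) C = A E - E A` if `Z` commutes with `C` and `A` is itself of the form
`Z' + B̃` with `Z'` commuting with `C`. -/
theorem commutator_of_sub_tilde {X A B : Matrix (Fin p.natDegree) (Fin p.natDegree) F}
    (hX : X - tilde A ∈ centralizerOf (companionMatrix p))
    (hA : A - tilde B ∈ centralizerOf (companionMatrix p)) :
    companionMatrix p * X - X * companionMatrix p =
      A * cornerMatrix F p.natDegree - cornerMatrix F p.natDegree * A := by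
  rw [mem_centralizerOf] at hX hA
  have h1 := commutator_tilde hA
  have h2 : tilde (A - tilde B) = tilde A := by
    have := tilde_add (A - tilde B) (tilde B)
    rw [sub_add_cancel, tilde_tilde, add_zero] at this
    exact this.symm
  rw [h2, sub_mul, mul_sub (cornerMatrix F _), tilde_mul_cornerMatrix, cornerMatrix_mul_tilde,
    sub_zero, sub_zero] at h1
  rw [← h1, ← sub_eq_zero]
  rw [mul_sub, sub_mul, ← sub_eq_zero] at hX
  rw [← hX]
  abel

/-- `tilde A` solves the same equation as X, and two solutions differ by a matrix commuting with C.
-/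
theorem sub_tilde_mem_of_commutator {X A B : Matrix (Fin p.natDegree) (Fin p.natDegree) F}
    (hX : companionMatrix p * X - X * companionMatrix p =
      A * cornerMatrix F p.natDegree - cornerMatrix F p.natDegree * A)
    (hA : A - tilde B ∈ centralizerOf (companionMatrix p)) :
    X - tilde A ∈ centralizerOf (companionMatrix p) := by
  have h := commutator_of_sub_tilde (X := tilde A) (by simp [zero_mem]) hA
  rw [mem_centralizerOf, mul_sub, sub_mul, ← sub_eq_zero]
  rw [← h, ← sub_eq_zero] at hX
  rw [← hX]
  abel

/-- Removing the common `tilde B` leaves the right-hand side unchanged, so `eq_of_commutator_eq`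
applies. -/
theorem eq_of_commutator_of_sub_tilde
    {X A A' B : Matrix (Fin p.natDegree) (Fin p.natDegree) F}
    (hA : A - tilde B ∈ centralizerOf (companionMatrix p))
    (hA' : A' - tilde B ∈ centralizerOf (companionMatrix p))
    (h : companionMatrix p * X - X * companionMatrix p =
      A * cornerMatrix F p.natDegree - cornerMatrix F p.natDegree * A') : A = A' := by
  have := eq_of_commutator_eq (X := X) (mem_centralizerOf.1 hA) (mem_centralizerOf.1 hA') (by
    rw [h, sub_mul, mul_sub (cornerMatrix F _), tilde_mul_cornerMatrix, cornerMatrix_mul_tilde,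
      sub_zero, sub_zero])
  exact sub_left_injective this

variable {κ : ℕ → ℕ → Matrix (Fin p.natDegree) (Fin p.natDegree) F} {I J : ℕ}

/-- A solution of the commutator equations on an `I × J` array, column `j + 1` of `κ` being
column `j` of the array, is constant along diagonals and has a prescribed shape. -/
theorem toeplitz_of_commutator (hcol : ∀ i, κ i 0 = 0) (hrow : ∀ i j, I ≤ i → κ i j = 0)
    (h : ∀ i j, i < I → j < J →
      companionMatrix p * κ i (j + 1) - κ i (j + 1) * companionMatrix p =
        κ i j * cornerMatrix F p.natDegree - cornerMatrix F p.natDegree * κ (i + 1) (j + 1)) :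
    ∀ j, j ≤ J → (∀ i, κ i j - tilde (κ (i + 1) j) ∈ centralizerOf (companionMatrix p)) ∧
      (∀ i, j < J → κ i j = κ (i + 1) (j + 1)) := by
  -- Within a column the induction climbs from the zero rows i ≥ I. Equality one row below makes the
  -- two tilde corrections agree, as the comparison of `κ i j` with `κ (i + 1) (j + 1)` needs.
  have step : ∀ j, j < J →
      (∀ i, κ i j - tilde (κ (i + 1) j) ∈ centralizerOf (companionMatrix p)) →
      ∀ n i, I ≤ i + n → κ i j = κ (i + 1) (j + 1) ∧
        κ i (j + 1) - tilde (κ (i + 1) (j + 1)) ∈ centralizerOf (companionMatrix p) := by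
    intro j hj hjc n
    induction n with
    | zero =>
      intro i hi
      rw [hrow i _ hi, hrow (i + 1) _ (by omega), hrow i _ hi]
      simp [zero_mem]
    | succ n ih =>
      intro i hi
      by_cases hI : I ≤ i
      · exact ih i (by omega)
      obtain ⟨ih1, ih2⟩ := ih (i + 1) (by omega)
      have heq := h i j (by omega) hj
      have h1 : κ i j = κ (i + 1) (j + 1) :=
        eq_of_commutator_of_sub_tilde (hjc i) (by rw [ih1]; exact ih2) heq
      refine ⟨h1, ?_⟩
      rw [h1] at heq
      exact sub_tilde_mem_of_commutator heq ih2
  have hmem : ∀ j, j ≤ J →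
      ∀ i, κ i j - tilde (κ (i + 1) j) ∈ centralizerOf (companionMatrix p) := by
    intro j
    induction j with
    | zero => intro _ i; simp [hcol, zero_mem]
    | succ j ih =>
      intro hj i
      exact (step j (by omega) (ih (by omega)) I i (by omega)).2
  exact fun j hj => ⟨hmem j hj, fun i hj' => (step j hj' (hmem j hj) I i (by omega)).1⟩

theorem commutator_of_toeplitz
    (hJ : ∀ i, κ i J - tilde (κ (i + 1) J) ∈ centralizerOf (companionMatrix p))
    (hT : ∀ i j, j < J → κ i j = κ (i + 1) (j + 1)) (i j : ℕ) (hj : j < J) :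
    companionMatrix p * κ i (j + 1) - κ i (j + 1) * companionMatrix p =
      κ i j * cornerMatrix F p.natDegree - cornerMatrix F p.natDegree * κ (i + 1) (j + 1) := by
  -- Constancy along diagonals carries the membership back from the last column to every column.
  have hmem : ∀ n j i, j + n = J →
      κ i j - tilde (κ (i + 1) j) ∈ centralizerOf (companionMatrix p) := by
    intro n
    induction n with
    | zero => rintro j i rfl; exact hJ i
    | succ n ih =>
      intro j i hj
      rw [hT i j (by omega), hT (i + 1) j (by omega)]
      exact ih (j + 1) (i + 1) (by omega)
  rw [hT i j hj]
  exact commutator_of_sub_tilde (hmem (J - (j + 1)) _ _ (by omega))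
    (hmem (J - (j + 1)) (j + 1) (i + 1) (by omega))

end Toeplitz

/-! ### The centralizer equation for W, block by block -/

section Entries

variable {F : Type*} [Field F] {m : ℕ} {α : Fin m → ℕ} {L s : ℕ}

/-- The `s × s` block in row `a` and column `b` of `K_{i,j}`, taken to be zero outside the range
of the indices. -/
def ent (K : Matrix (WeyrIndex α L s) (WeyrIndex α L s) F) (i j a b : ℕ) :
    Matrix (Fin s) (Fin s) F :=
  if h : (i ≤ L ∧ j ≤ L) ∧ a < conjPart α i ∧ b < conjPart α j then
    blk K i j h.1.1 h.1.2 ⟨a, h.2.1⟩ ⟨b, h.2.2⟩ else 0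

theorem blk_apply (K : Matrix (WeyrIndex α L s) (WeyrIndex α L s) F) {i j : ℕ} (hi : i ≤ L)
    (hj : j ≤ L) (a : Fin (conjPart α i)) (b : Fin (conjPart α j)) :
    blk K i j hi hj a b = ent K i j a b := by
  rw [ent, dif_pos ⟨⟨hi, hj⟩, a.isLt, b.isLt⟩]

theorem apply_eq_ent (K : Matrix (WeyrIndex α L s) (WeyrIndex α L s) F) (x y : WeyrIndex α L s) :
    K x y = ent K x.1 y.1 x.2.1 y.2.1 x.2.2 y.2.2 := by
  rw [← blk_apply K (Fin.is_le _) (Fin.is_le _)]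
  rfl

theorem ent_eq_zero_of_le (K : Matrix (WeyrIndex α L s) (WeyrIndex α L s) F) {i j a b : ℕ}
    (h : conjPart α i ≤ a) : ent K i j a b = 0 :=
  dif_neg (by omega)

theorem ent_eq_zero_of_lt (K : Matrix (WeyrIndex α L s) (WeyrIndex α L s) F) {i j a b : ℕ}
    (h : L < i) : ent K i j a b = 0 :=
  dif_neg (by omega)

theorem ent_ext {K K' : Matrix (WeyrIndex α L s) (WeyrIndex α L s) F}
    (h : ∀ i j a b, i ≤ L → j ≤ L → a < conjPart α i → b < conjPart α j →
      ent K i j a b = ent K' i j a b) : K = K' := by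
  ext x y
  rw [apply_eq_ent K, apply_eq_ent K',
    h _ _ _ _ (Fin.is_le _) (Fin.is_le _) x.2.1.isLt y.2.1.isLt]

/-- The matrix with prescribed blocks. -/
def ofEnt (α : Fin m → ℕ) (L : ℕ) (f : ℕ → ℕ → ℕ → ℕ → Matrix (Fin s) (Fin s) F) :
    Matrix (WeyrIndex α L s) (WeyrIndex α L s) F :=
  Matrix.of fun x y => f x.1 y.1 x.2.1 y.2.1 x.2.2 y.2.2

theorem ent_ofEnt (f : ℕ → ℕ → ℕ → ℕ → Matrix (Fin s) (Fin s) F) {i j a b : ℕ} (hi : i ≤ L)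
    (hj : j ≤ L) (ha : a < conjPart α i) (hb : b < conjPart α j) :
    ent (ofEnt α L f) i j a b = f i j a b := by
  rw [ent, dif_pos ⟨⟨hi, hj⟩, ha, hb⟩]
  rfl

/-- Letting `G` take natural numbers avoids transport between the types `Fin (τ i)`. -/
theorem sum_fin_fin_ite {M : Type*} [AddCommMonoid M] (N t a : ℕ) (τ : ℕ → ℕ)
    (G : ℕ → ℕ → M) :
    (∑ i : Fin (N + 1), ∑ c : Fin (τ i), if (i : ℕ) = t ∧ (c : ℕ) = a then G i c else 0) =
      if t ≤ N ∧ a < τ t then G t a else 0 := by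
  have h1 : ∀ i : ℕ, (∑ c : Fin (τ i), if i = t ∧ (c : ℕ) = a then G i c else 0) =
      if i = t then (if a < τ t then G t a else 0) else 0 := by
    intro i
    rw [Fin.sum_univ_eq_sum_range (fun c => if i = t ∧ c = a then G i c else 0)]
    by_cases h : i = t
    · subst h
      simp [Finset.sum_ite_eq']
    · simp [h]
  simp_rw [h1]
  rw [Fin.sum_univ_eq_sum_range (fun i => if i = t then (if a < τ t then G t a else 0) else 0),
    Finset.sum_ite_eq', ← ite_and]
  simp

theorem sum_weyrIndex (f : WeyrIndex α L s → F) :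
    ∑ x, f x = ∑ i : Fin (L + 1), ∑ c : Fin (conjPart α i), ∑ w : Fin s, f ⟨i, c, w⟩ := by
  rw [Fintype.sum_sigma]
  simp_rw [Fintype.sum_prod_type]

variable {p : F[X]}

theorem weyrBlock_apply (i j : ℕ) (a : Fin (conjPart α i)) (b : Fin (conjPart α j)) :
    weyrBlock p α i j a b =
      (if j = i ∧ (b : ℕ) = (a : ℕ) then companionMatrix p else 0) +
      (if j = i + 1 ∧ (b : ℕ) = (a : ℕ) then cornerMatrix F p.natDegree else 0) := by
  simp only [weyrBlock, Matrix.of_apply, eq_comm (a := (b : ℕ))]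
  by_cases h : j = i
  · simp [h]
  · simp [h]

variable (K : Matrix (WeyrIndex α L p.natDegree) (WeyrIndex α L p.natDegree) F)

theorem weyrMatrix_mul_apply (i j : ℕ) (hi : i ≤ L) (hj : j ≤ L) (a : Fin (conjPart α i))
    (b : Fin (conjPart α j)) (u v : Fin p.natDegree) :
    (weyrMatrix p α L * K) ⟨⟨i, Nat.lt_succ_of_le hi⟩, a, u⟩ ⟨⟨j, Nat.lt_succ_of_le hj⟩, b, v⟩ =
      (companionMatrix p * ent K i j a b +
        cornerMatrix F p.natDegree * ent K (i + 1) j a b) u v := by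
  rw [Matrix.mul_apply, sum_weyrIndex]
  have h : ∀ (i' : Fin (L + 1)) (c : Fin (conjPart α i')),
      (∑ w : Fin p.natDegree, weyrMatrix p α L ⟨⟨i, Nat.lt_succ_of_le hi⟩, a, u⟩ ⟨i', c, w⟩ *
        K ⟨i', c, w⟩ ⟨⟨j, Nat.lt_succ_of_le hj⟩, b, v⟩) =
      (if (i' : ℕ) = i ∧ (c : ℕ) = a then (companionMatrix p * ent K i' j c b) u v else 0) +
      (if (i' : ℕ) = i + 1 ∧ (c : ℕ) = a then
        (cornerMatrix F p.natDegree * ent K i' j c b) u v else 0) := by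
    intro i' c
    have h1 : (∑ w : Fin p.natDegree,
        weyrMatrix p α L ⟨⟨i, Nat.lt_succ_of_le hi⟩, a, u⟩ ⟨i', c, w⟩ *
        K ⟨i', c, w⟩ ⟨⟨j, Nat.lt_succ_of_le hj⟩, b, v⟩) =
        (weyrBlock p α i i' a c * ent K i' j c b) u v := by
      rw [Matrix.mul_apply]
      exact Finset.sum_congr rfl fun w _ => by rw [apply_eq_ent K]; rfl
    rw [h1, weyrBlock_apply, add_mul, Matrix.add_apply]
    congr 1 <;> split_ifs <;> simp
  simp_rw [h, Finset.sum_add_distrib]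
  rw [sum_fin_fin_ite L i a (conjPart α)
      (fun i' c => (companionMatrix p * ent K i' j c b) u v),
    sum_fin_fin_ite L (i + 1) a (conjPart α)
      (fun i' c => (cornerMatrix F p.natDegree * ent K i' j c b) u v),
    if_pos ⟨hi, a.isLt⟩, Matrix.add_apply]
  congr 1
  -- If i = L or τ_{i+1} ≤ a, no E occurs in this row of W; the zero default of `ent` gives the same
  -- value.
  split_ifs with h
  · rfl
  · rw [ent, dif_neg (by omega)]
    simp

theorem mul_weyrMatrix_apply (i j : ℕ) (hi : i ≤ L) (hj : j ≤ L) (a : Fin (conjPart α i))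
    (b : Fin (conjPart α j)) (u v : Fin p.natDegree) :
    (K * weyrMatrix p α L) ⟨⟨i, Nat.lt_succ_of_le hi⟩, a, u⟩ ⟨⟨j, Nat.lt_succ_of_le hj⟩, b, v⟩ =
      (ent K i j a b * companionMatrix p +
        (if j = 0 then 0 else ent K i (j - 1) a b) * cornerMatrix F p.natDegree) u v := by
  rw [Matrix.mul_apply, sum_weyrIndex]
  have h : ∀ (j' : Fin (L + 1)) (c : Fin (conjPart α j')),
      (∑ w : Fin p.natDegree, K ⟨⟨i, Nat.lt_succ_of_le hi⟩, a, u⟩ ⟨j', c, w⟩ *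
        weyrMatrix p α L ⟨j', c, w⟩ ⟨⟨j, Nat.lt_succ_of_le hj⟩, b, v⟩) =
      (if (j' : ℕ) = j ∧ (c : ℕ) = b then (ent K i j' a c * companionMatrix p) u v else 0) +
      (if (j' : ℕ) = j - 1 ∧ (c : ℕ) = b then
        ((if j = 0 then 0 else ent K i j' a c) * cornerMatrix F p.natDegree) u v else 0) := by
    intro j' c
    have h1 : (∑ w : Fin p.natDegree, K ⟨⟨i, Nat.lt_succ_of_le hi⟩, a, u⟩ ⟨j', c, w⟩ *
        weyrMatrix p α L ⟨j', c, w⟩ ⟨⟨j, Nat.lt_succ_of_le hj⟩, b, v⟩) =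
        (ent K i j' a c * weyrBlock p α j' j c b) u v := by
      rw [Matrix.mul_apply]
      exact Finset.sum_congr rfl fun w _ => by rw [apply_eq_ent K]; rfl
    rw [h1, weyrBlock_apply, mul_add, Matrix.add_apply]
    simp only [eq_comm (a := j) (b := (j' : ℕ)), eq_comm (a := (b : ℕ)) (b := (c : ℕ))]
    congr 1
    · split_ifs <;> simp
    · by_cases hj0 : j = 0
      · simp [hj0]
      · have : j = (j' : ℕ) + 1 ↔ (j' : ℕ) = j - 1 := by omega
        simp only [this, hj0, if_false]
        split_ifs <;> simp
  simp_rw [h, Finset.sum_add_distrib]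
  rw [sum_fin_fin_ite L j b (conjPart α)
      (fun j' c => (ent K i j' a c * companionMatrix p) u v),
    sum_fin_fin_ite L (j - 1) b (conjPart α)
      (fun j' c => ((if j = 0 then 0 else ent K i j' a c) * cornerMatrix F p.natDegree) u v),
    if_pos ⟨hj, b.isLt⟩, Matrix.add_apply]
  congr 1
  by_cases hj0 : j = 0
  · simp [hj0]
  · split_ifs with h
    · rfl
    · rw [ent, dif_neg (by omega)]
      simp

/-- The positions a and b are the same in every term: C and E act on block diagonals, so distinct
pairs (a, b) never interact. -/
theorem mem_centralizerOf_weyrMatrix :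
    K ∈ centralizerOf (weyrMatrix p α L) ↔
      ∀ i j a b, i ≤ L → j ≤ L → a < conjPart α i → b < conjPart α j →
        companionMatrix p * ent K i j a b - ent K i j a b * companionMatrix p =
          (if j = 0 then 0 else ent K i (j - 1) a b) * cornerMatrix F p.natDegree -
            cornerMatrix F p.natDegree * ent K (i + 1) j a b := by
  rw [mem_centralizerOf]
  constructor
  · intro h i j a b hi hj ha hb
    rw [sub_eq_sub_iff_add_eq_add, add_comm _ (ent K i j a b * _)]
    ext u v
    rw [← weyrMatrix_mul_apply K i j hi hj ⟨a, ha⟩ ⟨b, hb⟩ u v, h,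
      mul_weyrMatrix_apply K i j hi hj ⟨a, ha⟩ ⟨b, hb⟩ u v]
  · intro h
    ext ⟨⟨i, hi⟩, a, u⟩ ⟨⟨j, hj⟩, b, v⟩
    rw [weyrMatrix_mul_apply K i j (by omega) (by omega) a b u v,
      mul_weyrMatrix_apply K i j (by omega) (by omega) a b u v]
    have h1 := h i j a b (by omega) (by omega) a.isLt b.isLt
    rw [sub_eq_sub_iff_add_eq_add, add_comm _ (ent K i j a b * _)] at h1
    rw [h1]

end Entries

/-! ### The recursion for single entries and its explicit solution -/

section EntryRecursion

variable {F : Type*} [Field F] {m : ℕ} {α : Fin m → ℕ} {L s : ℕ}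

theorem antitone_conjPart (α : Fin m → ℕ) : Antitone (conjPart α) :=
  antitone_nat_of_succ_le (conjPart_succ_le α)

/-- If `conjPart α (L + 1) = 0`, each row of the Young diagram ends at some index. -/
theorem exists_lt_conjPart_iff (hτ : conjPart α (L + 1) = 0) (b : ℕ) :
    ∃ J ≤ L + 1, ∀ j, b < conjPart α j ↔ j < J := by
  classical
  have hex : ∃ j, conjPart α j ≤ b := ⟨L + 1, by omega⟩
  refine ⟨Nat.find hex, Nat.find_le (by omega), fun j => ?_⟩
  rw [Nat.lt_find_iff]
  constructor
  · intro h k hk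
    have := antitone_conjPart α hk
    omega
  · intro h
    have := h j le_rfl
    omega

/-- The recursive construction of `K`, block by block: `f` holds the free blocks. -/
structure EntryRecursion (K : Matrix (WeyrIndex α L s) (WeyrIndex α L s) F)
    (f : ℕ → ℕ → ℕ → ℕ → Matrix (Fin s) (Fin s) F) : Prop where
  lower : ∀ i j a b, j < i → ent K i j a b = 0
  -- This covers all kinds of free blocks: the tilde term is zero for the X blocks, where τ_{i+1} ≤
  -- a, and on the diagonal, where the block in row i + 1 vanishes.
  last : ∀ i j a b, i ≤ j → j ≤ L → a < conjPart α i → conjPart α (j + 1) ≤ b →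
    b < conjPart α j → ent K i j a b = f i j a b + tilde (ent K (i + 1) j a b)
  shift : ∀ i j a b, i ≤ j → j < L → b < conjPart α (j + 1) →
    ent K i j a b = ent K (i + 1) (j + 1) a b

/-- The solution of the recursion, for the blocks in column `b`, when `b` occurs in the block
columns `0, …, J - 1`: here `i` is the row number of the diagonal in question in its last
column. -/
def solution (α : Fin m → ℕ) (f : ℕ → ℕ → ℕ → ℕ → Matrix (Fin s) (Fin s) F) (J i a b : ℕ) :
    Matrix (Fin s) (Fin s) F :=
  -- Rows i ≥ J lie below the diagonal in column J − 1. One tilde suffices in the next line because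
  -- `tilde` squares to zero.
  let g := fun i => if i < J ∧ a < conjPart α i then f i (J - 1) a b else 0
  g i + tilde (g (i + 1))

theorem solution_eq_zero_of_le {f : ℕ → ℕ → ℕ → ℕ → Matrix (Fin s) (Fin s) F}
    {J i a b : ℕ} (h : J ≤ i) : solution α f J i a b = 0 := by
  simp [solution, show ¬ i < J by omega, show ¬ i + 1 < J by omega]

theorem solution_eq_zero_of_conjPart_le {f : ℕ → ℕ → ℕ → ℕ → Matrix (Fin s) (Fin s) F}
    {J i a b : ℕ} (h : conjPart α i ≤ a) : solution α f J i a b = 0 := by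
  have := conjPart_succ_le α i
  simp [solution, show ¬ a < conjPart α i by omega, show ¬ a < conjPart α (i + 1) by omega]

theorem solution_eq_add {f : ℕ → ℕ → ℕ → ℕ → Matrix (Fin s) (Fin s) F}
    {J i a b : ℕ} (hi : i < J) (ha : a < conjPart α i) :
    solution α f J i a b = f i (J - 1) a b + tilde (solution α f J (i + 1) a b) := by
  simp only [solution, tilde_add, tilde_tilde, add_zero]
  rw [if_pos ⟨hi, ha⟩]

/-- The diagonal through (i, j) meets the last column J b − 1 in row i + (J b − (j + 1)); `shift`
moves there, and `last` is then solved upwards from the zero rows. -/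
theorem entryRecursion_iff (hτ : conjPart α (L + 1) = 0) {J : ℕ → ℕ} (hJL : ∀ b, J b ≤ L + 1)
    (hJ : ∀ b j, b < conjPart α j ↔ j < J b)
    {K : Matrix (WeyrIndex α L s) (WeyrIndex α L s) F}
    {f : ℕ → ℕ → ℕ → ℕ → Matrix (Fin s) (Fin s) F} :
    EntryRecursion K f ↔ ∀ i j a b, i ≤ L → j ≤ L → a < conjPart α i → b < conjPart α j →
      ent K i j a b = solution α f (J b) (i + (J b - (j + 1))) a b := by
  constructor
  · intro h
    have hlast : ∀ a b j, j + 1 = J b → ∀ n i, i + n = L + 1 →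
        ent K i j a b = solution α f (J b) i a b := by
      intro a b j hj n
      induction n with
      | zero =>
        intro i hi
        rw [ent_eq_zero_of_lt K (by omega), solution_eq_zero_of_le (by have := hJL b; omega)]
      | succ n ih =>
        intro i hi
        by_cases ha : a < conjPart α i
        · by_cases hij : i ≤ j
          · have h1 : ¬ b < conjPart α (j + 1) := by rw [hJ]; omega
            have := hJL b
            rw [h.last i j a b hij (by omega) ha (by omega) (by rw [hJ]; omega),
              ih _ (by omega), solution_eq_add (by omega) ha, ← hj, Nat.add_sub_cancel]
          · rw [h.lower _ _ _ _ (by omega), solution_eq_zero_of_le (by omega)]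
        · rw [ent_eq_zero_of_le K (by omega), solution_eq_zero_of_conjPart_le (by omega)]
    have key : ∀ a b n i j, j + 1 + n = J b → i ≤ L + 1 →
        ent K i j a b = solution α f (J b) (i + n) a b := by
      intro a b n
      induction n with
      | zero =>
        intro i j hj hi
        exact hlast a b j hj (L + 1 - i) i (by omega)
      | succ n ih =>
        intro i j hj hi
        have := hJL b
        by_cases hij : i ≤ j
        · rw [h.shift i j a b hij (by omega) (by rw [hJ]; omega), ih _ _ (by omega) (by omega),
            add_right_comm, add_assoc]
        · rw [h.lower _ _ _ _ (by omega), solution_eq_zero_of_le (by omega)]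
    intro i j a b hi hj ha hb
    rw [hJ] at hb
    exact key a b _ i j (by omega) (by omega)
  · intro h
    have key : ∀ i j a b, b < conjPart α j →
        ent K i j a b = solution α f (J b) (i + (J b - (j + 1))) a b := by
      intro i j a b hb
      have hb' := (hJ b j).1 hb
      have := hJL b
      by_cases ha : a < conjPart α i
      · by_cases hi : i ≤ L
        · exact h i j a b hi (by omega) ha hb
        · have := antitone_conjPart α (show L + 1 ≤ i by omega)
          omega
      · have := antitone_conjPart α (show i ≤ i + (J b - (j + 1)) by omega)
        rw [ent_eq_zero_of_le K (by omega), solution_eq_zero_of_conjPart_le (by omega)]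
    refine ⟨fun i j a b hij => ?_, fun i j a b hij hj ha hb hb' => ?_,
      fun i j a b hij hj hb => ?_⟩
    · by_cases hb : b < conjPart α j
      · have := (hJ b j).1 hb
        rw [key _ _ _ _ hb, solution_eq_zero_of_le (by omega)]
      · exact dif_neg (by omega)
    · have h1 := (hJ b j).1 hb'
      have h2 : ¬ j + 1 < J b := by rw [← hJ]; omega
      have h3 : J b = j + 1 := by omega
      rw [key _ _ _ _ hb', key _ _ _ _ hb', h3, Nat.sub_self, add_zero, add_zero,
        solution_eq_add (by omega) ha, Nat.add_sub_cancel]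
    · have h1 := (hJ b _).1 hb
      have := conjPart_succ_le α j
      rw [key _ _ _ _ hb, key _ _ _ _ (by omega)]
      congr 1
      omega

theorem existsUnique_entryRecursion (hτ : conjPart α (L + 1) = 0)
    (f : ℕ → ℕ → ℕ → ℕ → Matrix (Fin s) (Fin s) F) :
    ∃! K : Matrix (WeyrIndex α L s) (WeyrIndex α L s) F, EntryRecursion K f := by
  choose J hJL hJ using exists_lt_conjPart_iff (α := α) hτ
  simp_rw [entryRecursion_iff hτ hJL hJ]
  refine ⟨ofEnt α L fun i j a b => solution α f (J b) (i + (J b - (j + 1))) a b,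
    fun i j a b hi hj ha hb => ent_ofEnt _ hi hj ha hb, fun K hK => ent_ext ?_⟩
  intro i j a b hi hj ha hb
  rw [hK i j a b hi hj ha hb, ent_ofEnt _ hi hj ha hb]

/-- Recovers the free blocks from K, whence their uniqueness. -/
theorem EntryRecursion.eq_sub {K : Matrix (WeyrIndex α L s) (WeyrIndex α L s) F}
    {f : ℕ → ℕ → ℕ → ℕ → Matrix (Fin s) (Fin s) F} (h : EntryRecursion K f) {i j a b : ℕ}
    (hij : i ≤ j) (hj : j ≤ L) (ha : a < conjPart α i) (hb : conjPart α (j + 1) ≤ b)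
    (hb' : b < conjPart α j) : f i j a b = ent K i j a b - tilde (ent K (i + 1) j a b) := by
  rw [h.last i j a b hij hj ha hb hb', add_sub_cancel_right]

variable {p : F[X]} {K : Matrix (WeyrIndex α L p.natDegree) (WeyrIndex α L p.natDegree) F}

theorem EntryRecursion.mem_centralizerOf (hτ : conjPart α (L + 1) = 0)
    {f : ℕ → ℕ → ℕ → ℕ → Matrix (Fin p.natDegree) (Fin p.natDegree) F}
    (hf : ∀ i j a b, f i j a b ∈ centralizerOf (companionMatrix p)) (h : EntryRecursion K f) :
    K ∈ centralizerOf (weyrMatrix p α L) := by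
  rw [mem_centralizerOf_weyrMatrix]
  intro i j a b hi hj ha hb
  obtain ⟨J, hJL, hJ⟩ := exists_lt_conjPart_iff (α := α) hτ b
  have hjJ := (hJ j).1 hb
  -- A zero column is prepended, so column j of K is column j + 1 of `κ`.
  let κ : ℕ → ℕ → Matrix (Fin p.natDegree) (Fin p.natDegree) F :=
    fun i j => if j = 0 then 0 else ent K i (j - 1) a b
  have h1 := commutator_of_toeplitz (κ := κ) (J := J) ?_ ?_ i j hjJ
  · simpa [κ] using h1
  · intro i
    have h0 : J ≠ 0 := by omega
    simp only [κ, h0, if_false]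
    have hb1 : b < conjPart α (J - 1) := by rw [hJ]; omega
    have hb2 : ¬ b < conjPart α (J - 1 + 1) := by rw [hJ]; omega
    by_cases hia : a < conjPart α i
    · by_cases hij : i ≤ J - 1
      · rw [← h.eq_sub hij (by omega) hia (by omega) hb1]
        exact hf _ _ _ _
      · rw [h.lower _ _ _ _ (by omega), h.lower _ _ _ _ (by omega)]
        simp [zero_mem]
    · have := conjPart_succ_le α i
      rw [ent_eq_zero_of_le K (by omega), ent_eq_zero_of_le K (by omega)]
      simp [zero_mem]
  · rintro i (_ | j) hj
    · simp only [κ, if_true, Nat.add_sub_cancel]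
      simp [h.lower (i + 1) 0 a b (by omega)]
    · simp only [κ, Nat.succ_ne_zero, if_false, Nat.add_sub_cancel]
      by_cases hij : i ≤ j
      · exact h.shift i j a b hij (by omega) (by rw [hJ]; omega)
      · rw [h.lower _ _ _ _ (by omega), h.lower _ _ _ _ (by omega)]

theorem toeplitz_of_mem_centralizerOf (hτ : conjPart α (L + 1) = 0)
    (hK : K ∈ centralizerOf (weyrMatrix p α L)) {a b J : ℕ}
    (hJ : ∀ j, b < conjPart α j ↔ j < J) (hJL : J ≤ L + 1) :
    (∀ i j, j < J → ent K i j a b - tilde (ent K (i + 1) j a b) ∈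
      centralizerOf (companionMatrix p)) ∧
    (∀ i j, j + 1 < J → ent K i j a b = ent K (i + 1) (j + 1) a b) ∧
    (∀ i, 0 < J → ent K (i + 1) 0 a b = 0) := by
  rw [mem_centralizerOf_weyrMatrix] at hK
  obtain ⟨I, hIL, hI⟩ := exists_lt_conjPart_iff (α := α) hτ a
  let κ : ℕ → ℕ → Matrix (Fin p.natDegree) (Fin p.natDegree) F :=
    fun i j => if j = 0 then 0 else ent K i (j - 1) a b
  have h1 := toeplitz_of_commutator (κ := κ) (I := I) (J := J) (by simp [κ]) ?_ ?_
  · refine ⟨fun i j hj => ?_, fun i j hj => ?_, fun i hJ0 => ?_⟩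
    · simpa [κ] using (h1 (j + 1) hj).1 i
    · simpa [κ] using (h1 (j + 1) hj.le).2 i hj
    · simpa [κ] using ((h1 0 hJ0.le).2 i hJ0).symm
  · intro i j hi
    have : ¬ a < conjPart α i := by rw [hI]; omega
    simp only [κ]
    rw [ent_eq_zero_of_le K (by omega), ite_self]
  · intro i j hi hj
    simpa [κ] using hK i j a b (by omega) (by omega) ((hI i).2 hi) ((hJ j).2 hj)

theorem entryRecursion_of_mem_centralizerOf (hτ : conjPart α (L + 1) = 0)
    (hK : K ∈ centralizerOf (weyrMatrix p α L)) :
    EntryRecursion K fun i j a b => ent K i j a b - tilde (ent K (i + 1) j a b) := by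
  refine ⟨?_, fun _ _ _ _ _ _ _ _ _ => (sub_add_cancel _ _).symm, ?_⟩
  · intro i j a b
    obtain ⟨J, hJL, hJ⟩ := exists_lt_conjPart_iff (α := α) hτ b
    obtain ⟨-, h2, h3⟩ := toeplitz_of_mem_centralizerOf (a := a) hτ hK hJ hJL
    -- A block below the diagonal is moved along its diagonal back to column 0, where `h3` makes it
    -- zero.
    induction j generalizing i with
    | zero =>
      intro hi
      obtain ⟨i, rfl⟩ := Nat.exists_eq_add_of_lt hi
      by_cases hJ0 : 0 < J
      · rw [zero_add]
        exact h3 i hJ0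
      · have : ¬ b < conjPart α 0 := by rw [hJ]; omega
        exact dif_neg (by omega)
    | succ j ih =>
      intro hi
      by_cases hj : j + 1 < J
      · obtain ⟨i, rfl⟩ : ∃ i', i = i' + 1 := ⟨i - 1, by omega⟩
        rw [← h2 i j hj]
        exact ih i (by omega)
      · have : ¬ b < conjPart α (j + 1) := by rw [hJ]; omega
        exact dif_neg (by omega)
  · intro i j a b _ _ hb
    obtain ⟨J, hJL, hJ⟩ := exists_lt_conjPart_iff (α := α) hτ b
    exact (toeplitz_of_mem_centralizerOf (a := a) hτ hK hJ hJL).2.1 i j ((hJ _).1 hb)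

theorem sub_tilde_ent_mem (hτ : conjPart α (L + 1) = 0)
    (hK : K ∈ centralizerOf (weyrMatrix p α L)) (i j a b : ℕ) :
    ent K i j a b - tilde (ent K (i + 1) j a b) ∈ centralizerOf (companionMatrix p) := by
  obtain ⟨J, hJL, hJ⟩ := exists_lt_conjPart_iff (α := α) hτ b
  by_cases hj : j < J
  · exact (toeplitz_of_mem_centralizerOf (a := a) hτ hK hJ hJL).1 i j hj
  · have hb : ¬ b < conjPart α j := by rw [hJ]; omega
    have : ∀ i, ent K i j a b = 0 := fun i => dif_neg (by omega)
    simp [this, zero_mem]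

end EntryRecursion

/-! ### Translation between free blocks and entries -/

section FreeBlocks

variable {m : ℕ} {α : Fin m → ℕ} {L : ℕ}

@[simp] theorem val_splitEquiv_inl (i : ℕ) (a : Fin (conjPart α (i + 1))) :
    (splitEquiv α i (Sum.inl a) : ℕ) = a := by
  simp [splitEquiv]

@[simp] theorem val_splitEquiv_inr (i : ℕ) (a : Fin (conjPart α i - conjPart α (i + 1))) :
    (splitEquiv α i (Sum.inr a) : ℕ) = conjPart α (i + 1) + a := by
  simp [splitEquiv]

@[simp] theorem glue_splitEquiv {M : Type*} [Zero M] (i j : ℕ)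
    (A : Matrix (Fin (conjPart α (i + 1))) (Fin (conjPart α (j + 1))) M)
    (Y : Matrix (Fin (conjPart α (i + 1))) (Fin (conjPart α j - conjPart α (j + 1))) M)
    (X : Matrix (Fin (conjPart α i - conjPart α (i + 1)))
      (Fin (conjPart α j - conjPart α (j + 1))) M) (x y) :
    glue α i j A Y X (splitEquiv α i x) (splitEquiv α j y) = Matrix.fromBlocks A Y 0 X x y := by
  simp [glue]

@[simp] theorem stack_splitEquiv {M q : Type*} (i : ℕ)
    (Y : Matrix (Fin (conjPart α (i + 1))) q M)
    (X : Matrix (Fin (conjPart α i - conjPart α (i + 1))) q M) (x y) :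
    stack α i Y X (splitEquiv α i x) y = Matrix.fromRows Y X x y := by
  simp [stack]

/-- The free blocks with entries given by a function of the block indices and of the positions
within a block. -/
def FreeBlocks.ofEntries {Z : Type*} (α : Fin m → ℕ) (L : ℕ) (f : ℕ → ℕ → ℕ → ℕ → Z) :
    FreeBlocks α L Z where
  corner := Matrix.of fun a b => f L L a b
  lastX i _ := Matrix.of fun a b => f i L (conjPart α (i + 1) + a) b
  lastY' i _ := Matrix.of fun a b => f i L a b
  X i j _ _ := Matrix.of fun a b => f i j (conjPart α (i + 1) + a) (conjPart α (j + 1) + b)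
  Y' i j _ _ := Matrix.of fun a b => f i j a (conjPart α (j + 1) + b)

/-- The value z fills the positions that no free block occupies. -/
theorem FreeBlocks.exists_eq_ofEntries {Z : Type*} [Nonempty Z] (P : FreeBlocks α L Z) :
    ∃ f, P = FreeBlocks.ofEntries α L f := by
  obtain ⟨z⟩ := ‹Nonempty Z›
  obtain ⟨c, x, y, X, Y⟩ := P
  refine ⟨fun i j a b =>
    if hj : j < L then
      if h : i ≤ j ∧ b - conjPart α (j + 1) < conjPart α j - conjPart α (j + 1) then
        if ha : a < conjPart α (i + 1) then Y i j h.1 hj ⟨a, ha⟩ ⟨b - conjPart α (j + 1), h.2⟩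
        else if ha' : a - conjPart α (i + 1) < conjPart α i - conjPart α (i + 1) then
          X i j h.1 hj ⟨a - conjPart α (i + 1), ha'⟩ ⟨b - conjPart α (j + 1), h.2⟩
        else z
      else z
    else if hb : b < conjPart α L then
      if hi : i < L then
        if ha : a < conjPart α (i + 1) then y i hi ⟨a, ha⟩ ⟨b, hb⟩
        else if ha' : a - conjPart α (i + 1) < conjPart α i - conjPart α (i + 1) then
          x i hi ⟨a - conjPart α (i + 1), ha'⟩ ⟨b, hb⟩
        else z
      else if ha : a < conjPart α L then c ⟨a, ha⟩ ⟨b, hb⟩ else z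
    else z, ?_⟩
  simp only [ofEntries, FreeBlocks.mk.injEq]
  refine ⟨?_, ?_, ?_, ?_, ?_⟩
  · ext a b
    simp
  · ext i hi a b
    simp [hi]
  · ext i hi a b
    simp [hi]
  · ext i j hij hj a b
    simp [hj, hij]
  · ext i j hij hj a b
    simp [hj, hij]

theorem FreeBlocks.ofEntries_congr {Z : Type*} {f g : ℕ → ℕ → ℕ → ℕ → Z}
    (hτ : conjPart α (L + 1) = 0)
    (h : ∀ i j a b, i ≤ j → j ≤ L → a < conjPart α i → conjPart α (j + 1) ≤ b →
      b < conjPart α j → f i j a b = g i j a b) : ofEntries α L f = ofEntries α L g := by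
  simp only [ofEntries, FreeBlocks.mk.injEq]
  refine ⟨?_, ?_, ?_, ?_, ?_⟩
  · ext a b
    exact h _ _ _ _ le_rfl le_rfl a.isLt (by omega) b.isLt
  · ext i hi a b
    exact h _ _ _ _ hi.le le_rfl (by omega) (by omega) b.isLt
  · ext i hi a b
    have := conjPart_succ_le α i
    exact h _ _ _ _ hi.le le_rfl (by omega) (by omega) b.isLt
  · ext i j hij hj a b
    exact h _ _ _ _ hij hj.le (by omega) (by omega) (by omega)
  · ext i j hij hj a b
    have := conjPart_succ_le α i
    exact h _ _ _ _ hij hj.le (by omega) (by omega) (by omega)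

variable {F : Type*} [Field F] {s : ℕ} {Z : Set (Matrix (Fin s) (Fin s) F)}
  {K : Matrix (WeyrIndex α L s) (WeyrIndex α L s) F} {f : ℕ → ℕ → ℕ → ℕ → Z}

theorem BuiltWith.entryRecursion (hτ : conjPart α (L + 1) = 0) {YL Y}
    (h : BuiltWith K (FreeBlocks.ofEntries α L f) YL Y) :
    EntryRecursion K fun i j a b => (f i j a b : Matrix (Fin s) (Fin s) F) := by
  have hlast : ∀ i b (hi : i < L) (hb : b < conjPart α L) x,
      ent K i L (splitEquiv α i x : Fin _) b =
        Matrix.fromRows (YL i) (((FreeBlocks.ofEntries α L f).lastX i hi).map Subtype.val)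
          x ⟨b, hb⟩ := by
    intro i b hi hb x
    rw [← stack_splitEquiv, ← h.last i hi, blk_apply]
  have hglue : ∀ i j (hij : i ≤ j) (hj : j < L) x y,
      ent K i j (splitEquiv α i x : Fin _) (splitEquiv α j y : Fin _) =
        Matrix.fromBlocks (blk K (i + 1) (j + 1) (by omega) hj) (Y i j) 0
          (((FreeBlocks.ofEntries α L f).X i j hij hj).map Subtype.val) x y := by
    intro i j hij hj x y
    rw [← glue_splitEquiv]
    obtain rfl | hlt := hij.eq_or_lt
    · rw [← h.diag i hj, blk_apply]
    · rw [← h.upper i j hlt hj, blk_apply]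
  refine ⟨?_, ?_, ?_⟩
  · intro i j a b hji
    rw [ent]
    split_ifs with hr
    · rw [h.lower i j hr.1.1 hji]
      rfl
    · rfl
  · intro i j a b hij hj ha hb hb'
    obtain rfl | hjL := hj.eq_or_lt
    · obtain rfl | hi := hij.eq_or_lt
      · rw [ent_eq_zero_of_lt K (Nat.lt_succ_self _), tilde_zero, add_zero]
        have := blk_apply K le_rfl le_rfl ⟨a, ha⟩ ⟨b, hb'⟩
        rw [h.corner] at this
        exact this.symm
      · obtain ⟨x, hx⟩ := (splitEquiv α i).surjective ⟨a, ha⟩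
        have h1 := hlast i b hi hb' x
        rw [hx] at h1
        rw [h1]
        obtain x | x := x
        · have hx' : (x : ℕ) = a := by rw [← val_splitEquiv_inl i x, hx]
          simp [h.lastY i hi, FreeBlocks.ofEntries, blk_apply, hx']
        · have hx' : conjPart α (i + 1) + (x : ℕ) = a := by rw [← val_splitEquiv_inr i x, hx]
          rw [ent_eq_zero_of_le K (by omega)]
          simp [FreeBlocks.ofEntries, hx']
    · obtain ⟨x, hx⟩ := (splitEquiv α i).surjective ⟨a, ha⟩
      obtain ⟨y | y, hy⟩ := (splitEquiv α j).surjective ⟨b, hb'⟩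
      · have hy' : (y : ℕ) = b := by rw [← val_splitEquiv_inl j y, hy]
        omega
      have hy' : conjPart α (j + 1) + (y : ℕ) = b := by rw [← val_splitEquiv_inr j y, hy]
      have h1 := hglue i j hij hjL x (Sum.inr y)
      rw [hx, hy] at h1
      rw [h1]
      obtain x | x := x
      · have hx' : (x : ℕ) = a := by rw [← val_splitEquiv_inl i x, hx]
        obtain rfl | hlt := hij.eq_or_lt
        · have : ent K (i + 1) i a b = 0 := by
            rw [ent]
            split_ifs with hr
            · rw [h.lower _ _ hr.1.1 (Nat.lt_succ_self _)]
              rfl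
            · rfl
          simp [h.diagY i hjL, FreeBlocks.ofEntries, hx', hy', this]
        -- The tilde term involves block row i + 1, whose own splitting into Y and X parts is now
        -- needed.
        · obtain ⟨x', hx''⟩ := (splitEquiv α (i + 1)).surjective x
          have h2 := hglue (i + 1) j hlt hjL x' (Sum.inr y)
          rw [hx'', hy] at h2
          simp only [hx'] at h2
          rw [h2]
          rw [Matrix.fromBlocks_apply₁₂, h.upperY i j hlt hjL, ← hx'']
          simp only [Matrix.add_apply, Matrix.map_apply, stack_splitEquiv]
          congr 1
          · simp [FreeBlocks.ofEntries, hx'', hx', hy']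
          · obtain x' | x' := x' <;> simp
      · have hx' : conjPart α (i + 1) + (x : ℕ) = a := by rw [← val_splitEquiv_inr i x, hx]
        rw [ent_eq_zero_of_le K (by omega)]
        simp [FreeBlocks.ofEntries, hx', hy']
  · intro i j a b hij hj hb
    by_cases ha : a < conjPart α i
    · have hb' := conjPart_succ_le α j
      obtain ⟨x, hx⟩ := (splitEquiv α i).surjective ⟨a, ha⟩
      have h1 := hglue i j hij hj x (Sum.inl ⟨b, hb⟩)
      rw [hx, val_splitEquiv_inl] at h1
      simp only at h1
      rw [h1]
      obtain x | x := x
      · have hx' : (x : ℕ) = a := by rw [← val_splitEquiv_inl i x, hx]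
        simp [blk_apply, hx']
      · have hx' : conjPart α (i + 1) + (x : ℕ) = a := by rw [← val_splitEquiv_inr i x, hx]
        rw [ent_eq_zero_of_le K (by omega)]
        simp
    · have := conjPart_succ_le α i
      rw [ent_eq_zero_of_le K (by omega), ent_eq_zero_of_le K (by omega)]

theorem EntryRecursion.isBuiltFrom (hτ : conjPart α (L + 1) = 0)
    (h : EntryRecursion K fun i j a b => (f i j a b : Matrix (Fin s) (Fin s) F)) :
    IsBuiltFrom K (FreeBlocks.ofEntries α L f) := by
  have hglue : ∀ i j (hij : i ≤ j) (hj : j < L),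
      blk K i j (by omega) hj.le = glue α i j (blk K (i + 1) (j + 1) (by omega) hj)
        (Matrix.of fun a b => ent K i j a (conjPart α (j + 1) + b))
        (((FreeBlocks.ofEntries α L f).X i j hij hj).map Subtype.val) := by
    intro i j hij hj
    ext1 a b
    obtain ⟨x, rfl⟩ := (splitEquiv α i).surjective a
    obtain ⟨y, rfl⟩ := (splitEquiv α j).surjective b
    rw [glue_splitEquiv, blk_apply]
    obtain y | y := y
    · rw [val_splitEquiv_inl, h.shift _ _ _ _ hij hj y.isLt]
      obtain x | x := x
      · simp [blk_apply]
      · rw [ent_eq_zero_of_le K (by simp)]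
        simp
    · obtain x | x := x
      · simp
      · rw [val_splitEquiv_inr, val_splitEquiv_inr,
          h.last _ _ _ _ hij hj.le (by omega) (by omega) (by omega),
          ent_eq_zero_of_le K (by omega)]
        simp [FreeBlocks.ofEntries]
  -- The matrices Y are forced: they are read off from K itself.
  refine ⟨fun i => Matrix.of fun a b => ent K i L a b,
    fun i j => Matrix.of fun a b => ent K i j a (conjPart α (j + 1) + b), ?_⟩
  constructor
  case lower =>
    intro i j hi hji
    ext1 a b
    rw [blk_apply, h.lower _ _ _ _ hji]
    rfl
  case corner =>
    ext1 a b
    rw [blk_apply, h.last _ _ _ _ le_rfl le_rfl a.isLt (by omega) b.isLt,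
      ent_eq_zero_of_lt K (Nat.lt_succ_self _)]
    simp [FreeBlocks.ofEntries]
  case diag => exact fun i hi => hglue i i le_rfl hi
  case diagY =>
    intro i hi
    ext1 a b
    have := conjPart_succ_le α i
    rw [Matrix.of_apply, h.last _ _ _ _ le_rfl hi.le (by omega) (by omega) (by omega),
      h.lower _ _ _ _ (Nat.lt_succ_self i)]
    simp [FreeBlocks.ofEntries]
  case last =>
    intro i hi
    ext1 a b
    obtain ⟨x, rfl⟩ := (splitEquiv α i).surjective a
    rw [stack_splitEquiv, blk_apply]
    obtain x | x := x
    · simp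
    · rw [val_splitEquiv_inr, h.last _ _ _ _ hi.le le_rfl (by omega) (by omega) (by omega),
          ent_eq_zero_of_le K (by omega)]
      simp [FreeBlocks.ofEntries]
  case lastY =>
    intro i hi
    ext1 a b
    have := conjPart_succ_le α i
    rw [Matrix.of_apply, h.last _ _ _ _ hi.le le_rfl (by omega) (by omega) b.isLt]
    simp [FreeBlocks.ofEntries, blk_apply]
  case upper => exact fun i j hij hj => hglue i j hij.le hj
  case upperY =>
    intro i j hij hj
    ext1 a b
    have := conjPart_succ_le α i
    rw [Matrix.of_apply, h.last _ _ _ _ hij.le hj.le (by omega) (by omega) (by omega)]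
    rw [Matrix.add_apply, Matrix.map_apply, Matrix.map_apply]
    congr 2
    obtain ⟨x, rfl⟩ := (splitEquiv α (i + 1)).surjective a
    rw [stack_splitEquiv]
    obtain x | x := x
    · simp
    · rw [val_splitEquiv_inr, h.last _ _ _ _ (show i + 1 ≤ j from hij) hj.le (by omega) (by omega)
          (by omega), ent_eq_zero_of_le K (by omega)]
      simp [FreeBlocks.ofEntries]

theorem isBuiltFrom_ofEntries (hτ : conjPart α (L + 1) = 0) :
    IsBuiltFrom K (FreeBlocks.ofEntries α L f) ↔
      EntryRecursion K fun i j a b => (f i j a b : Matrix (Fin s) (Fin s) F) :=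
  ⟨fun ⟨_, _, h⟩ => h.entryRecursion hτ, fun h => h.isBuiltFrom hτ⟩

theorem det_eq_prod_det_blk (hK : K.BlockTriangular Sigma.fst) :
    K.det = ∏ i : Fin (L + 1),
      (Matrix.comp _ _ _ _ F (blk K i i (Fin.is_le i) (Fin.is_le i))).det := by
  rw [hK.det_fintype]
  refine Finset.prod_congr rfl fun i _ => ?_
  rw [← Matrix.det_submatrix_equiv_self (Equiv.sigmaSubtype i).symm]
  rfl

end FreeBlocks

end GenWeyr

/-! ### The structure theorem -/

theorem theorem6p1 {F : Type*} [Field F] (p : Polynomial F) (hmonic : p.Monic)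
    (hirr : Irreducible p) {m : ℕ} [NeZero m] (α : Fin m → ℕ) (hα : Antitone α)
    (L : ℕ) (hL : α 0 = L + 1) :
    (∀ K ∈ GenWeyr.centralizerOf (GenWeyr.weyrMatrix p α L),
      K.BlockTriangular Sigma.fst ∧
      (∃! P : GenWeyr.FreeBlocks α L
          (GenWeyr.centralizerOf (GenWeyr.companionMatrix p) : Set (Matrix _ _ F)),
        GenWeyr.IsBuiltFrom K P) ∧
      K.det = ∏ i : Fin (L + 1),
        (Matrix.comp _ _ _ _ F (GenWeyr.blk K i i (Fin.is_le i) (Fin.is_le i))).det) ∧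
    (∀ P : GenWeyr.FreeBlocks α L
        (GenWeyr.centralizerOf (GenWeyr.companionMatrix p) : Set (Matrix _ _ F)),
      ∃! K : Matrix (GenWeyr.WeyrIndex α L p.natDegree) (GenWeyr.WeyrIndex α L p.natDegree) F,
        GenWeyr.IsBuiltFrom K P) ∧
    (∀ (P : GenWeyr.FreeBlocks α L
          (GenWeyr.centralizerOf (GenWeyr.companionMatrix p) : Set (Matrix _ _ F)))
        (K : Matrix (GenWeyr.WeyrIndex α L p.natDegree) (GenWeyr.WeyrIndex α L p.natDegree) F),
      GenWeyr.IsBuiltFrom K P → K ∈ GenWeyr.centralizerOf (GenWeyr.weyrMatrix p α L)) := by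
  -- No part exceeds α_1 = L + 1. With τ_{L+1} = 0 the last block column obeys the same rule as the
  -- others, all of its columns being free.
  have hτ : GenWeyr.conjPart α (L + 1) = 0 := by
    simp only [GenWeyr.conjPart, Finset.card_eq_zero, Finset.filter_eq_empty_iff]
    intro k _
    have := hα (Fin.zero_le k)
    omega
  have : Nonempty (GenWeyr.centralizerOf (GenWeyr.companionMatrix p) :
      Set (Matrix (Fin p.natDegree) (Fin p.natDegree) F)) :=
    ⟨⟨0, (GenWeyr.centralizerOf (GenWeyr.companionMatrix p)).zero_mem⟩⟩
  refine ⟨fun K hK => ?_, fun P => ?_, fun P K hKP => ?_⟩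
  · have hrec := GenWeyr.entryRecursion_of_mem_centralizerOf hτ hK
    have htri : K.BlockTriangular Sigma.fst := by
      intro x y hxy
      rw [GenWeyr.apply_eq_ent K, hrec.lower _ _ _ _ hxy]
      rfl
    refine ⟨htri, ?_, GenWeyr.det_eq_prod_det_blk htri⟩
    refine ⟨GenWeyr.FreeBlocks.ofEntries α L fun i j a b =>
      ⟨_, GenWeyr.sub_tilde_ent_mem hτ hK i j a b⟩,
      (GenWeyr.isBuiltFrom_ofEntries hτ).2 hrec, fun P hP => ?_⟩
    obtain ⟨f, rfl⟩ := P.exists_eq_ofEntries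
    have hf := (GenWeyr.isBuiltFrom_ofEntries hτ).1 hP
    refine GenWeyr.FreeBlocks.ofEntries_congr hτ fun i j a b hij hj ha hb hb' => ?_
    exact Subtype.ext (hf.eq_sub hij hj ha hb hb')
  · obtain ⟨f, rfl⟩ := P.exists_eq_ofEntries
    simp_rw [GenWeyr.isBuiltFrom_ofEntries hτ]
    exact GenWeyr.existsUnique_entryRecursion hτ _
  · obtain ⟨f, rfl⟩ := P.exists_eq_ofEntries
    exact ((GenWeyr.isBuiltFrom_ofEntries hτ).1 hKP).mem_centralizerOf hτ
      fun i j a b => (f i j a b).2
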